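/- **Epstein's Theorem.** Let $n\ge 0$ be an integer, let $B\in M_n(\mathbb C)$ be any complex $n\times n$ matrix, and let $0\le p\le 1$. Let $M_n^+(\mathbb C)$ denote the convex cone of positive semidefinite matrices in $M_n(\mathbb C)$, and for $X\in M_n^+(\mathbb C)$ and real $r\ge 0$ let $X^r$ be defined by the spectral functional calculus (with $X^0=I$). Then the real-valued map $$A\longmapsto \operatorname{tr}\big[(B^*A^pB)^{1/p}\big]$$ is concave on $M_n^+(\mathbb C)$: for all $A_1,A_2\in M_n^+(\mathbb C)$ and $0\le\lambda\le1$, $$\lambda\operatorname{tr}\big[(B^*A_1^pB)^{1/p}\big]+(1-\lambda)\operatorname{tr}\big[(B^*A_2^pB)^{1/p}\big]\le \operatorname{tr}\Big[\big(B^*(\lambda A_1+(1-\lambda)A_2)^pB\big)^{1/p}\Big].$$ The substance is the range $0<p\le 1$. For $p=0$ the exponent $1/p$ is read as $0$ by convention, and the map is then constant and so trivially concave. -/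

import Mathlib

open scoped Matrix MatrixOrder ComplexOrder

/-- The functional `A ↦ tr[(Bᴴ A ^ p B) ^ (1/p)]`. Real powers of matrices are taken in the
continuous functional calculus (`CFC.rpow`). For positive semidefinite `A` the matrix
`(Bᴴ A ^ p B) ^ (1/p)` is positive semidefinite, so its trace is real and `re` loses nothing;
see `ofReal_epsteinTrace`. -/
noncomputable def epsteinTrace {n : ℕ} (B : Matrix (Fin n) (Fin n) ℂ) (p : ℝ)
    (A : Matrix (Fin n) (Fin n) ℂ) : ℝ :=
  (((Bᴴ * A ^ p * B) ^ (1 / p)).trace).re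

/-- Taking the real part in `epsteinTrace` is harmless: the trace is a real number. -/
theorem ofReal_epsteinTrace {n : ℕ} (B : Matrix (Fin n) (Fin n) ℂ) (p : ℝ)
    (A : Matrix (Fin n) (Fin n) ℂ) :
    (epsteinTrace B p A : ℂ) = ((Bᴴ * A ^ p * B) ^ (1 / p)).trace := by
  have h : (0 : Matrix (Fin n) (Fin n) ℂ) ≤ (Bᴴ * A ^ p * B) ^ (1 / p) := CFC.rpow_nonneg
  have h2 := (Matrix.nonneg_iff_posSemidef.mp h).trace_nonneg
  exact Complex.ext rfl (by simpa using (Complex.le_def.mp h2).2)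

open MeasureTheory Set

/-! With `Y = Bᴴ A ^ p B` and `0 < p < 1`, Young's inequality for traces gives `p tr Y ^ (1/p) =
max_X (tr (Y X ^ (1 - p)) - (1 - p) tr X)`, attained at `X = Y ^ (1/p)`. By Lieb's theorem the
bracket is jointly concave in `(A, X)`, and a partial maximum of a jointly concave function is
concave.

Lieb's theorem follows by writing `a ^ p x ^ (1 - p)` as a positive integral over `t` of parallel
sums `a x / (a + t x)`. Each of these, applied to left multiplication by `A` and right
multiplication by `X`, is a minimum over `Z` of expressions linear in `(A, X)`, hence concave. -/

lemma posSemidef_combo {m : Type*} {A₁ A₂ : Matrix m m ℂ} (h₁ : A₁.PosSemidef) (h₂ : A₂.PosSemidef) {c d : ℝ}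
    (hc : 0 ≤ c) (hd : 0 ≤ d) : (c • A₁ + d • A₂).PosSemidef :=
  (h₁.smul hc).add (h₂.smul hd)

/-! ### Traces in a pair of eigenbases -/

variable {m : Type*} [Fintype m] [DecidableEq m]

/-- The sum `∑ φ(aᵢ, xⱼ) |⟨uᵢ, K vⱼ⟩|²` over the eigenpairs `(aᵢ, uᵢ)` of `A` and `(xⱼ, vⱼ)`
of `X`. -/
noncomputable def spectralForm {A X : Matrix m m ℂ} (hA : A.IsHermitian) (hX : X.IsHermitian)
    (φ : ℝ → ℝ → ℝ) (K : Matrix m m ℂ) : ℝ :=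
  ∑ i, ∑ j, φ (hA.eigenvalues i) (hX.eigenvalues j) *
    ‖(star (hA.eigenvectorUnitary : Matrix m m ℂ) * K * hX.eigenvectorUnitary) i j‖ ^ 2

lemma trace_conjTranspose_mul_diagonal_mul_mul_diagonal (L : Matrix m m ℂ) (d e : m → ℝ) :
    (Lᴴ * Matrix.diagonal (fun i => (d i : ℂ)) * L * Matrix.diagonal (fun i => (e i : ℂ))).trace.re
      = ∑ i, ∑ j, d i * e j * ‖L i j‖ ^ 2 := by
  rw [Finset.sum_comm]
  simp only [Matrix.trace, Matrix.diag_apply, Matrix.mul_diagonal, Complex.re_sum]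
  refine Finset.sum_congr rfl fun j _ => ?_
  rw [Matrix.mul_apply]
  simp only [Matrix.mul_diagonal, Matrix.conjTranspose_apply, Finset.sum_mul, Complex.re_sum]
  refine Finset.sum_congr rfl fun i _ => ?_
  rw [← Complex.normSq_eq_norm_sq, Complex.normSq_apply]
  simp
  ring

lemma trace_cfc_mul_cfc {A X : Matrix m m ℂ} (hA : A.IsHermitian) (hX : X.IsHermitian)
    (f g : ℝ → ℝ) (K : Matrix m m ℂ) :
    (Kᴴ * cfc f A * K * cfc g X).trace.re = spectralForm hA hX (fun a x => f a * g x) K := by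
  rw [spectralForm, ← trace_conjTranspose_mul_diagonal_mul_mul_diagonal, hA.cfc_eq, hX.cfc_eq,
    Matrix.IsHermitian.cfc, Matrix.IsHermitian.cfc, Unitary.conjStarAlgAut_apply,
    Unitary.conjStarAlgAut_apply, ← mul_assoc, Matrix.trace_mul_comm]
  simp only [Matrix.conjTranspose_mul, Matrix.star_eq_conjTranspose,
    Matrix.conjTranspose_conjTranspose, mul_assoc]
  rfl

lemma trace_conjTranspose_mul_mul {A X : Matrix m m ℂ} (hA : A.IsHermitian) (hX : X.IsHermitian)
    (K : Matrix m m ℂ) :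
    (Kᴴ * A * K).trace.re = spectralForm hA hX (fun a _ => a) K := by
  have h := trace_cfc_mul_cfc hA hX (fun a => a) (fun _ => 1) K
  rw [cfc_id' ℝ A hA.isSelfAdjoint, cfc_const_one ℝ X hX.isSelfAdjoint] at h
  simpa using h

lemma trace_conjTranspose_mul_self_mul {A X : Matrix m m ℂ} (hA : A.IsHermitian)
    (hX : X.IsHermitian) (K : Matrix m m ℂ) :
    (Kᴴ * K * X).trace.re = spectralForm hA hX (fun _ x => x) K := by
  have h := trace_cfc_mul_cfc hA hX (fun _ => 1) (fun x => x) K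
  rw [cfc_id' ℝ X hX.isSelfAdjoint, cfc_const_one ℝ A hA.isSelfAdjoint] at h
  simpa using h

/-! ### Parallel sums as minima -/

/-- After the triangle inequality, the gap is a perfect square over `a + t * x`. -/
lemma parallelSum_mul_norm_sq_le {a x t : ℝ} (ha : 0 ≤ a) (hx : 0 ≤ x) (ht : 0 < t) (k z : ℂ) :
    t * (a * x / (a + t * x)) * ‖k‖ ^ 2 ≤ a * ‖k - z‖ ^ 2 + t * (x * ‖z‖ ^ 2) := by
  rcases (add_nonneg ha (mul_nonneg ht.le hx)).eq_or_lt with h | h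
  · rw [← h]; simp; positivity
  have h1 : ‖k‖ ≤ ‖k - z‖ + ‖z‖ := by simpa using norm_add_le (k - z) z
  have h2 : ‖k‖ ^ 2 ≤ (‖k - z‖ + ‖z‖) ^ 2 := by gcongr
  calc t * (a * x / (a + t * x)) * ‖k‖ ^ 2
      ≤ t * (a * x / (a + t * x)) * (‖k - z‖ + ‖z‖) ^ 2 := by gcongr
    _ ≤ _ := by
        rw [← sub_nonneg]
        have : a * ‖k - z‖ ^ 2 + t * (x * ‖z‖ ^ 2)
            - t * (a * x / (a + t * x)) * (‖k - z‖ + ‖z‖) ^ 2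
            = (a * ‖k - z‖ - t * x * ‖z‖) ^ 2 / (a + t * x) := by
          field_simp
          ring
        rw [this]
        positivity

/-- The minimiser is `z = a / (a + t x) * k`. If `a + t x = 0`, then `a = 0` and both sides vanish.
-/
lemma parallelSum_mul_norm_sq_eq {a x t : ℝ} (ha : 0 ≤ a) (hx : 0 ≤ x) (ht : 0 < t) (k : ℂ) :
    a * ‖k - (a / (a + t * x) : ℝ) * k‖ ^ 2 + t * (x * ‖(a / (a + t * x) : ℝ) * k‖ ^ 2)
      = t * (a * x / (a + t * x)) * ‖k‖ ^ 2 := by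
  have e : k - (a / (a + t * x) : ℝ) * k = ((1 - a / (a + t * x) : ℝ) : ℂ) * k := by
    push_cast; ring
  rw [e, norm_mul, norm_mul, mul_pow, mul_pow, Complex.norm_real, Complex.norm_real,
    Real.norm_eq_abs, Real.norm_eq_abs, sq_abs, sq_abs]
  rcases (add_nonneg ha (mul_nonneg ht.le hx)).eq_or_lt with h | h
  · have h0 : a = 0 := by nlinarith [mul_nonneg ht.le hx]
    simp [h0]
  · field_simp
    ring

lemma spectralForm_parallelSum_le {A X : Matrix m m ℂ} (hA : A.PosSemidef) (hX : X.PosSemidef)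
    {t : ℝ} (ht : 0 < t) (K Z : Matrix m m ℂ) :
    t * spectralForm hA.1 hX.1 (fun a x => a * x / (a + t * x)) K
      ≤ ((K - Z)ᴴ * A * (K - Z)).trace.re + t * (Zᴴ * Z * X).trace.re := by
  rw [trace_conjTranspose_mul_mul hA.1 hX.1, trace_conjTranspose_mul_self_mul hA.1 hX.1]
  simp only [spectralForm, Finset.mul_sum, ← Finset.sum_add_distrib]
  refine Finset.sum_le_sum fun i _ => Finset.sum_le_sum fun j _ => ?_
  rw [mul_sub, sub_mul, Matrix.sub_apply, ← mul_assoc]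
  exact parallelSum_mul_norm_sq_le (hA.eigenvalues_nonneg i) (hX.eigenvalues_nonneg j) ht _ _

lemma exists_spectralForm_parallelSum_eq {A X : Matrix m m ℂ} (hA : A.PosSemidef)
    (hX : X.PosSemidef) {t : ℝ} (ht : 0 < t) (K : Matrix m m ℂ) :
    ∃ Z : Matrix m m ℂ, ((K - Z)ᴴ * A * (K - Z)).trace.re + t * (Zᴴ * Z * X).trace.re
      = t * spectralForm hA.1 hX.1 (fun a x => a * x / (a + t * x)) K := by
  set U := (hA.1.eigenvectorUnitary : Matrix m m ℂ) with hU
  set V := (hX.1.eigenvectorUnitary : Matrix m m ℂ) with hV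
  -- In the two eigenbases the minimisation decouples, so each entry takes its scalar minimiser.
  let W : Matrix m m ℂ := Matrix.of fun i j =>
    ((hA.1.eigenvalues i / (hA.1.eigenvalues i + t * hX.1.eigenvalues j) : ℝ) : ℂ)
      * (star U * K * V) i j
  have hUU : star U * U = 1 := Unitary.coe_star_mul_self hA.1.eigenvectorUnitary
  have hVV : star V * V = 1 := Unitary.coe_star_mul_self hX.1.eigenvectorUnitary
  have hW : star U * (U * W * star V) * V = W := by
    calc star U * (U * W * star V) * V = (star U * U) * W * (star V * V) := by
          simp only [mul_assoc]
      _ = W := by rw [hUU, hVV, one_mul, mul_one]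
  refine ⟨U * W * star V, ?_⟩
  rw [trace_conjTranspose_mul_mul hA.1 hX.1, trace_conjTranspose_mul_self_mul hA.1 hX.1]
  simp only [spectralForm, Finset.mul_sum, ← Finset.sum_add_distrib]
  refine Finset.sum_congr rfl fun i _ => Finset.sum_congr rfl fun j _ => ?_
  rw [mul_sub, sub_mul, Matrix.sub_apply, ← hU, ← hV, hW]
  exact (parallelSum_mul_norm_sq_eq (hA.eigenvalues_nonneg i) (hX.eigenvalues_nonneg j) ht
    ((star U * K * V) i j)).trans (mul_assoc _ _ _)

/-- Joint concavity of the parallel sum of left multiplication by `A` and right multiplication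
by `X`. -/
lemma spectralForm_parallelSum_concave {A₁ A₂ X₁ X₂ : Matrix m m ℂ} (hA₁ : A₁.PosSemidef)
    (hA₂ : A₂.PosSemidef) (hX₁ : X₁.PosSemidef) (hX₂ : X₂.PosSemidef) {c d : ℝ} (hc : 0 ≤ c)
    (hd : 0 ≤ d) {t : ℝ} (ht : 0 < t) (K : Matrix m m ℂ) :
    c * spectralForm hA₁.1 hX₁.1 (fun a x => a * x / (a + t * x)) K
      + d * spectralForm hA₂.1 hX₂.1 (fun a x => a * x / (a + t * x)) K
      ≤ spectralForm (posSemidef_combo hA₁ hA₂ hc hd).1 (posSemidef_combo hX₁ hX₂ hc hd).1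
          (fun a x => a * x / (a + t * x)) K := by
  -- The `Z` optimal for the combination is a competitor for both pairs, and the minimised
  -- expression is linear in `(A, X)`.
  obtain ⟨Z, hZ⟩ := exists_spectralForm_parallelSum_eq (posSemidef_combo hA₁ hA₂ hc hd)
    (posSemidef_combo hX₁ hX₂ hc hd) ht K
  have h₁ := mul_le_mul_of_nonneg_left (spectralForm_parallelSum_le hA₁ hX₁ ht K Z) hc
  have h₂ := mul_le_mul_of_nonneg_left (spectralForm_parallelSum_le hA₂ hX₂ ht K Z) hd
  simp only [mul_add, add_mul, Matrix.mul_smul, Matrix.smul_mul, Matrix.trace_add,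
    Matrix.trace_smul, Complex.add_re, Complex.smul_re, smul_eq_mul] at hZ
  refine le_of_mul_le_mul_left ?_ ht
  linarith

/-! ### Integral representation and Lieb's theorem -/

lemma mul_rpowIntegrand_div {p t a x : ℝ} (hp : p ∈ Ioo (0 : ℝ) 1) (ht : 0 < t) (ha : 0 ≤ a)
    (hx : 0 ≤ x) :
    x * Real.rpowIntegrand₀₁ p t (a / x) = t ^ (p - 1) * (a * x / (a + t * x)) := by
  rw [Real.rpowIntegrand₀₁_eq_pow_div hp ht.le (by positivity)]
  rcases hx.eq_or_lt with rfl | hx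
  · simp
  · field_simp
    ring

lemma rpow_mul_rpow_one_sub {p a x : ℝ} (hp : p ∈ Ioo (0 : ℝ) 1) (ha : 0 ≤ a) (hx : 0 ≤ x) :
    a ^ p * x ^ (1 - p) = x * (a / x) ^ p := by
  rcases hx.eq_or_lt with rfl | hx
  · rw [Real.zero_rpow (by linarith [hp.2])]; simp
  · rw [Real.div_rpow ha hx.le, Real.rpow_sub hx, Real.rpow_one]
    ring

lemma integrableOn_rpow_mul_parallelSum {p a x : ℝ} (hp : p ∈ Ioo (0 : ℝ) 1) (ha : 0 ≤ a)
    (hx : 0 ≤ x) :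
    IntegrableOn (fun t : ℝ => t ^ (p - 1) * (a * x / (a + t * x))) (Ioi 0) :=
  IntegrableOn.congr_fun
    ((Real.integrableOn_rpowIntegrand₀₁_Ioi hp (div_nonneg ha hx)).const_mul x)
    (fun _ ht => mul_rpowIntegrand_div hp ht ha hx) measurableSet_Ioi

lemma rpow_mul_rpow_one_sub_eq_integral {p a x : ℝ} (hp : p ∈ Ioo (0 : ℝ) 1) (ha : 0 ≤ a)
    (hx : 0 ≤ x) :
    a ^ p * x ^ (1 - p) = (∫ t in Ioi 0, Real.rpowIntegrand₀₁ p t 1)⁻¹ *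
      ∫ t in Ioi (0 : ℝ), t ^ (p - 1) * (a * x / (a + t * x)) := by
  rw [rpow_mul_rpow_one_sub hp ha hx, Real.rpow_eq_const_mul_integral hp (div_nonneg ha hx),
    mul_left_comm, ← integral_const_mul]
  congr 1
  exact setIntegral_congr_fun measurableSet_Ioi fun _ ht => mul_rpowIntegrand_div hp ht ha hx

lemma integrableOn_spectralForm_parallelSum {A X : Matrix m m ℂ} (hA : A.PosSemidef)
    (hX : X.PosSemidef) {p : ℝ} (hp : p ∈ Ioo (0 : ℝ) 1) (K : Matrix m m ℂ) :
    IntegrableOn (fun t : ℝ => t ^ (p - 1) *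
      spectralForm hA.1 hX.1 (fun a x => a * x / (a + t * x)) K) (Ioi 0) := by
  simp only [spectralForm, Finset.mul_sum, ← mul_assoc]
  exact integrable_finsetSum _ fun i _ => integrable_finsetSum _ fun j _ =>
    (integrableOn_rpow_mul_parallelSum hp (hA.eigenvalues_nonneg i)
      (hX.eigenvalues_nonneg j)).mul_const _

lemma spectralForm_rpow_eq_integral {A X : Matrix m m ℂ} (hA : A.PosSemidef)
    (hX : X.PosSemidef) {p : ℝ} (hp : p ∈ Ioo (0 : ℝ) 1) (K : Matrix m m ℂ) :
    spectralForm hA.1 hX.1 (fun a x => a ^ p * x ^ (1 - p)) K =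
      (∫ t in Ioi 0, Real.rpowIntegrand₀₁ p t 1)⁻¹ * ∫ t in Ioi (0 : ℝ), t ^ (p - 1) *
        spectralForm hA.1 hX.1 (fun a x => a * x / (a + t * x)) K := by
  have hint := fun i j => (integrableOn_rpow_mul_parallelSum hp (hA.eigenvalues_nonneg i)
    (hX.eigenvalues_nonneg j)).mul_const
      (‖(star (hA.1.eigenvectorUnitary : Matrix m m ℂ) * K * hX.1.eigenvectorUnitary) i j‖ ^ 2)
  simp only [spectralForm, Finset.mul_sum, ← mul_assoc] at hint ⊢
  rw [integral_finsetSum _ fun i _ => integrable_finsetSum _ fun j _ => hint i j, Finset.mul_sum]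
  refine Finset.sum_congr rfl fun i _ => ?_
  rw [integral_finsetSum _ fun j _ => hint i j, Finset.mul_sum]
  refine Finset.sum_congr rfl fun j _ => ?_
  rw [integral_mul_const, rpow_mul_rpow_one_sub_eq_integral hp (hA.eigenvalues_nonneg i)
    (hX.eigenvalues_nonneg j), mul_assoc]

/-- **Lieb's concavity theorem**: `(A, X) ↦ tr (Kᴴ A ^ p K X ^ (1 - p))` is jointly concave. -/
theorem trace_rpow_mul_rpow_concave {A₁ A₂ X₁ X₂ : Matrix m m ℂ} (hA₁ : A₁.PosSemidef)
    (hA₂ : A₂.PosSemidef) (hX₁ : X₁.PosSemidef) (hX₂ : X₂.PosSemidef) {c d : ℝ} (hc : 0 ≤ c)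
    (hd : 0 ≤ d) {p : ℝ} (hp : p ∈ Ioo (0 : ℝ) 1) (K : Matrix m m ℂ) :
    c * (Kᴴ * A₁ ^ p * K * X₁ ^ (1 - p)).trace.re + d * (Kᴴ * A₂ ^ p * K * X₂ ^ (1 - p)).trace.re
      ≤ (Kᴴ * (c • A₁ + d • A₂) ^ p * K * (c • X₁ + d • X₂) ^ (1 - p)).trace.re := by
  have hA := posSemidef_combo hA₁ hA₂ hc hd
  have hX := posSemidef_combo hX₁ hX₂ hc hd
  rw [CFC.rpow_eq_cfc_real hA₁.nonneg, CFC.rpow_eq_cfc_real hA₂.nonneg,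
    CFC.rpow_eq_cfc_real hX₁.nonneg, CFC.rpow_eq_cfc_real hX₂.nonneg,
    CFC.rpow_eq_cfc_real hA.nonneg, CFC.rpow_eq_cfc_real hX.nonneg,
    trace_cfc_mul_cfc hA₁.1 hX₁.1, trace_cfc_mul_cfc hA₂.1 hX₂.1, trace_cfc_mul_cfc hA.1 hX.1,
    spectralForm_rpow_eq_integral hA₁ hX₁ hp, spectralForm_rpow_eq_integral hA₂ hX₂ hp,
    spectralForm_rpow_eq_integral hA hX hp, mul_left_comm c, mul_left_comm d, ← mul_add]
  have i₁ := (integrableOn_spectralForm_parallelSum hA₁ hX₁ hp K).const_mul c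
  have i₂ := (integrableOn_spectralForm_parallelSum hA₂ hX₂ hp K).const_mul d
  refine mul_le_mul_of_nonneg_left ?_
    (inv_nonneg.2 (Real.integral_rpowIntegrand₀₁_one_pos hp).le)
  rw [← integral_const_mul, ← integral_const_mul, ← integral_add i₁ i₂]
  refine setIntegral_mono_on (i₁.add i₂) (integrableOn_spectralForm_parallelSum hA hX hp K)
    measurableSet_Ioi fun t ht => ?_
  rw [mul_left_comm c, mul_left_comm d, ← mul_add]
  exact mul_le_mul_of_nonneg_left (spectralForm_parallelSum_concave hA₁ hA₂ hX₁ hX₂ hc hd ht K)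
    (Real.rpow_nonneg (le_of_lt ht) _)

/-! ### Young's inequality for traces and its equality case -/

lemma mul_rpow_one_sub_le {p y x : ℝ} (hp : p ∈ Ioo (0 : ℝ) 1) (hy : 0 ≤ y) (hx : 0 ≤ x) :
    y * x ^ (1 - p) ≤ p * y ^ (1 / p) + (1 - p) * x := by
  have h := Real.geom_mean_le_arith_mean2_weighted hp.1.le (sub_nonneg.2 hp.2.le)
    (Real.rpow_nonneg hy (1 / p)) hx (by ring)
  rwa [← Real.rpow_mul hy, one_div_mul_cancel hp.1.ne', Real.rpow_one] at h

/-- Young's inequality for traces. -/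
lemma trace_mul_rpow_one_sub_le {Y X : Matrix m m ℂ} (hY : Y.PosSemidef) (hX : X.PosSemidef)
    {p : ℝ} (hp : p ∈ Ioo (0 : ℝ) 1) :
    (Y * X ^ (1 - p)).trace.re ≤ p * (Y ^ (1 / p)).trace.re + (1 - p) * X.trace.re := by
  have e₁ : (Y * X ^ (1 - p)).trace.re
      = spectralForm hY.1 hX.1 (fun y x => y * x ^ (1 - p)) 1 := by
    have h := trace_cfc_mul_cfc hY.1 hX.1 (fun y => y) (fun x => x ^ (1 - p)) 1
    rw [cfc_id' ℝ Y hY.1.isSelfAdjoint, ← CFC.rpow_eq_cfc_real hX.nonneg] at h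
    simpa using h
  have e₂ : (Y ^ (1 / p)).trace.re = spectralForm hY.1 hX.1 (fun y _ => y ^ (1 / p)) 1 := by
    have h := trace_cfc_mul_cfc hY.1 hX.1 (fun y => y ^ (1 / p)) (fun _ => 1) 1
    rw [cfc_const_one ℝ X hX.1.isSelfAdjoint, ← CFC.rpow_eq_cfc_real hY.nonneg] at h
    simpa using h
  have e₃ := trace_conjTranspose_mul_self_mul hY.1 hX.1 1
  rw [Matrix.conjTranspose_one, one_mul, one_mul] at e₃
  rw [e₁, e₂, e₃]
  simp only [spectralForm, Finset.mul_sum, ← Finset.sum_add_distrib, ← mul_assoc, ← add_mul]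
  -- The weights `|⟨uᵢ, vⱼ⟩|²` are nonnegative, so scalar Young applies termwise although `Y` and
  -- `X` need not commute.
  refine Finset.sum_le_sum fun i _ => Finset.sum_le_sum fun j _ => ?_
  exact mul_le_mul_of_nonneg_right
    (mul_rpow_one_sub_le hp (hY.eigenvalues_nonneg i) (hX.eigenvalues_nonneg j)) (by positivity)

/-- This gives equality in Young's inequality at `X = Y ^ (1 / p)`. -/
lemma mul_rpow_rpow_one_sub {Y : Matrix m m ℂ} (hY : Y.PosSemidef) {p : ℝ}
    (hp : p ∈ Ioo (0 : ℝ) 1) : Y * (Y ^ (1 / p)) ^ (1 - p) = Y ^ (1 / p) := by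
  have hp0 := hp.1
  have hp1 := sub_pos.2 hp.2
  rw [CFC.rpow_rpow_of_exponent_nonneg Y _ _ (by positivity) hp1.le hY.nonneg,
    CFC.rpow_eq_cfc_real hY.nonneg, CFC.rpow_eq_cfc_real hY.nonneg]
  nth_rw 1 [← cfc_id' ℝ Y hY.1.isSelfAdjoint]
  rw [← cfc_mul _ _ Y (by fun_prop) (Matrix.finite_real_spectrum.continuousOn _)]
  refine cfc_congr fun y hy => ?_
  have hy0 : 0 ≤ y := spectrum_nonneg_of_nonneg hY.nonneg hy
  have e : 1 / p = 1 + 1 / p * (1 - p) := by field_simp; ring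
  conv_rhs => rw [e]
  rw [Real.rpow_add' hy0 (by positivity), Real.rpow_one]

theorem epsteinTrace_concave_of_mem_Ioo {n : ℕ} (B : Matrix (Fin n) (Fin n) ℂ) {p : ℝ}
    (hp : p ∈ Ioo (0 : ℝ) 1) {A₁ A₂ : Matrix (Fin n) (Fin n) ℂ} (hA₁ : A₁.PosSemidef)
    (hA₂ : A₂.PosSemidef) {c d : ℝ} (hc : 0 ≤ c) (hd : 0 ≤ d) :
    c * epsteinTrace B p A₁ + d * epsteinTrace B p A₂ ≤ epsteinTrace B p (c • A₁ + d • A₂) := by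
  have hY : ∀ A : Matrix (Fin n) (Fin n) ℂ, (Bᴴ * A ^ p * B).PosSemidef := fun A =>
    (Matrix.nonneg_iff_posSemidef.1 CFC.rpow_nonneg).conjTranspose_mul_mul_same B
  have hX : ∀ A : Matrix (Fin n) (Fin n) ℂ, ((Bᴴ * A ^ p * B) ^ (1 / p)).PosSemidef := fun A =>
    Matrix.nonneg_iff_posSemidef.1 CFC.rpow_nonneg
  -- Each `Aᵢ` is paired with its own maximiser; their combination is only a competitor for `c • A₁
  -- + d • A₂`.
  have h₁ := trace_rpow_mul_rpow_concave hA₁ hA₂ (hX A₁) (hX A₂) hc hd hp B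
  have h₂ := trace_mul_rpow_one_sub_le (hY (c • A₁ + d • A₂))
    (posSemidef_combo (hX A₁) (hX A₂) hc hd) hp
  rw [mul_rpow_rpow_one_sub (hY A₁) hp, mul_rpow_rpow_one_sub (hY A₂) hp] at h₁
  simp only [Matrix.trace_add, Matrix.trace_smul, Complex.add_re, Complex.smul_re,
    smul_eq_mul] at h₂
  unfold epsteinTrace
  refine le_of_mul_le_mul_left ?_ hp.1
  linarith

theorem mainTheorem2 (n : ℕ) (B : Matrix (Fin n) (Fin n) ℂ) (p : ℝ) (hp0 : 0 ≤ p) (hp1 : p ≤ 1) :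
    ConcaveOn ℝ {A : Matrix (Fin n) (Fin n) ℂ | A.PosSemidef} (epsteinTrace B p) := by
  refine ⟨fun A₁ h₁ A₂ h₂ c d hc hd _ => posSemidef_combo h₁ h₂ hc hd,
    fun A₁ h₁ A₂ h₂ c d hc hd hcd => ?_⟩
  simp only [smul_eq_mul]
  rcases hp0.eq_or_lt with rfl | hp0
  -- Here `1 / 0 = 0`, so the outer power is the identity and the trace is `n`.
  · have hB : (0 : Matrix (Fin n) (Fin n) ℂ) ≤ Bᴴ * 1 * B := by
      simpa using (Matrix.posSemidef_conjTranspose_mul_self B).nonneg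
    have h : ∀ A : Matrix (Fin n) (Fin n) ℂ, A.PosSemidef → epsteinTrace B 0 A = n := by
      intro A hA
      rw [epsteinTrace, CFC.rpow_zero A hA.nonneg, div_zero, CFC.rpow_zero _ hB]
      simp
    rw [h A₁ h₁, h A₂ h₂, h _ (posSemidef_combo h₁ h₂ hc hd), ← add_mul, hcd, one_mul]
  rcases hp1.eq_or_lt with rfl | hp1
  · have h : ∀ A : Matrix (Fin n) (Fin n) ℂ, A.PosSemidef →
        epsteinTrace B 1 A = (Bᴴ * A * B).trace.re := by
      intro A hA
      rw [epsteinTrace, CFC.rpow_one A hA.nonneg, div_one,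
        CFC.rpow_one _ (hA.conjTranspose_mul_mul_same B).nonneg]
    rw [h A₁ h₁, h A₂ h₂, h _ (posSemidef_combo h₁ h₂ hc hd)]
    simp [mul_add, add_mul]
  · exact epsteinTrace_concave_of_mem_Ioo B ⟨hp0, hp1⟩ h₁ h₂ hc hd
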